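/- A continuum is a nonempty compact connected metric space; a subcontinuum of $X$ is a nonempty compact connected subset of $X$, and $C(X)$ is the set of all subcontinua of $X$ with the Hausdorff metric. A pseudo-arc is a nondegenerate, hereditarily indecomposable, chainable continuum. A subcontinuum $K$ of $X$ is terminal if every subcontinuum $L$ of $X$ that meets $K$ satisfies $K\subset L$ or $L\subset K$. Let $\Psi$ be a circle of pseudo-arcs, that is, a continuum with an open continuous surjection $\Pi:\Psi\to S^1$ all of whose point-inverses are terminal subcontinua of $\Psi$ and pseudo-arcs; put $P_\alpha=\Pi^{-1}(e^{i\alpha})$ for $\alpha\in[0,2\pi)$, so that $\Psi=\bigcup_{\alpha\in[0,2\pi)}P_\alpha$ (the Jones decomposition). Call $K\in C(\Psi)$ filament if there is an open set $U\supset K$ such that the component of $U$ containing $K$ has empty interior, and ample if for every open set $U\supset K$ there is $L\in C(\Psi)$ with $K\subset\operatorname{int}(L)\subset L\subset U$. Let $\mathcal F$ and $\mathcal A$ be the sets of filament and of ample subcontinua of $\Psi$. A minimal ample subcontinuum is an ample subcontinuum that properly contains no ample subcontinuum. Then the Planck boundary $\mathcal A\cap\overline{\mathcal F}$ (closure in $C(\Psi)$)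 is a continuum, and $$\mathcal A\cap\overline{\mathcal F}=\{K\in C(\Psi): K \text{ is a minimal ample subcontinuum of } \Psi\}=\{P_\alpha:\alpha\in[0,2\pi)\}.$$ -/

import Mathlib

open Set Topology TopologicalSpace

namespace PlanckBoundary

/-- A subset of a metric space that is a (sub)continuum: nonempty, compact and connected
(`IsConnected` includes nonemptiness). -/
def IsSubcontinuum {X : Type*} [TopologicalSpace X] (K : Set X) : Prop :=
  IsCompact K ∧ IsConnected K

/-- The hyperspace `C(X)` of all subcontinua of `X`. As a subtype of `NonemptyCompacts X` it
carries the Hausdorff metric and the order by inclusion. -/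
abbrev Hyperspace (X : Type*) [MetricSpace X] : Type _ :=
  {K : NonemptyCompacts X // IsConnected (K : Set X)}

/-- A subcontinuum is decomposable if it is the union of two proper subcontinua. -/
def IsDecomposable {X : Type*} [MetricSpace X] (K : Hyperspace X) : Prop :=
  ∃ A B : Hyperspace X, A ≠ K ∧ B ≠ K ∧ (A.1 : Set X) ∪ (B.1 : Set X) = (K.1 : Set X)

/-- Every subcontinuum is indecomposable. -/
def IsHereditarilyIndecomposable (X : Type*) [MetricSpace X] : Prop :=
  ∀ K : Hyperspace X, ¬ IsDecomposable K

/-- For every `ε > 0` there is a finite open cover `C₁, …, Cₙ` by sets of diameter less than `ε`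
in which two links meet if and only if their indices differ by at most one. -/
def IsChainable (X : Type*) [MetricSpace X] : Prop :=
  ∀ ε : ℝ, 0 < ε → ∃ (n : ℕ) (C : Fin n → Set X),
    (∀ k, IsOpen (C k)) ∧ (⋃ k, C k) = univ ∧ (∀ k, Metric.diam (C k) < ε) ∧
    ∀ k l : Fin n, (C k ∩ C l).Nonempty ↔ |((k : ℕ) : ℤ) - ((l : ℕ) : ℤ)| ≤ 1

/-- A pseudo-arc: a nondegenerate, hereditarily indecomposable, chainable continuum. -/
structure IsPseudoArc (X : Type*) [MetricSpace X] : Prop where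
  compactSpace : CompactSpace X
  connectedSpace : ConnectedSpace X
  nontrivial : Nontrivial X
  hereditarilyIndecomposable : IsHereditarilyIndecomposable X
  chainable : IsChainable X

/-- `K` is a terminal subcontinuum of `X`: every subcontinuum that meets `K` contains `K` or is
contained in `K`. -/
def IsTerminal {X : Type*} [MetricSpace X] (K : Set X) : Prop :=
  IsSubcontinuum K ∧ ∀ L : Set X, IsSubcontinuum L → (K ∩ L).Nonempty → K ⊆ L ∨ L ⊆ K

/-- A map is atomic if all its point-inverses are terminal subcontinua. -/
def IsAtomic {X Y : Type*} [MetricSpace X] (f : X → Y) : Prop :=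
  ∀ y, IsTerminal (f ⁻¹' {y})

/-- A Jones decomposition of `Ψ`, which makes a continuum `Ψ` a circle of pseudo-arcs: an open
atomic map onto the unit circle all of whose point-inverses are pseudo-arcs. -/
structure JonesDecomposition (Ψ : Type*) [MetricSpace Ψ] where
  proj : Ψ → Circle
  continuous_proj : Continuous proj
  surjective_proj : Function.Surjective proj
  isOpenMap_proj : IsOpenMap proj
  isAtomic_proj : IsAtomic proj
  isPseudoArc_fiber : ∀ y : Circle, IsPseudoArc (proj ⁻¹' {y})

/-- The terminal pseudo-arc `P_α = Π⁻¹(e^{iα})` as a point of the hyperspace. -/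
noncomputable def JonesDecomposition.P {Ψ : Type*} [MetricSpace Ψ] (D : JonesDecomposition Ψ)
    (α : ℝ) : Hyperspace Ψ :=
  ⟨⟨⟨D.proj ⁻¹' {Circle.exp α}, (D.isAtomic_proj _).1.1⟩, (D.isAtomic_proj _).1.2.nonempty⟩,
    (D.isAtomic_proj _).1.2⟩

/-- `K` is filament: some open `U ⊇ K` is such that the component of `U` containing `K` has empty
interior (as `K` is connected, that component is the component in `U` of any point of `K`). -/
def IsFilament {X : Type*} [MetricSpace X] (K : Hyperspace X) : Prop :=
  ∃ U : Set X, IsOpen U ∧ (K.1 : Set X) ⊆ U ∧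
    ∀ x ∈ (K.1 : Set X), interior (connectedComponentIn U x) = ∅

/-- `K` is ample: every open `U ⊇ K` contains a subcontinuum with `K` in its interior. -/
def IsAmple {X : Type*} [MetricSpace X] (K : Hyperspace X) : Prop :=
  ∀ U : Set X, IsOpen U → (K.1 : Set X) ⊆ U →
    ∃ L : Hyperspace X, (K.1 : Set X) ⊆ interior (L.1 : Set X) ∧ (L.1 : Set X) ⊆ U

/-- The filament portion of the hyperspace. -/
def filamentPortion (X : Type*) [MetricSpace X] : Set (Hyperspace X) := {K | IsFilament K}

/-- The ample portion of the hyperspace. -/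
def amplePortion (X : Type*) [MetricSpace X] : Set (Hyperspace X) := {K | IsAmple K}

/-- The Planck boundary: the ample portion intersected with the closure, in the hyperspace, of the
filament portion. -/
def planckBoundary (X : Type*) [MetricSpace X] : Set (Hyperspace X) :=
  amplePortion X ∩ closure (filamentPortion X)

/-- `K` is a minimal ample subcontinuum: ample, with no ample proper subcontinuum. -/
def IsMinimalAmple {X : Type*} [MetricSpace X] (K : Hyperspace X) : Prop :=
  IsAmple K ∧ ∀ L : Hyperspace X, IsAmple L → (L.1 : Set X) ⊆ (K.1 : Set X) → L = K

end PlanckBoundary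

/-!
Since the fibers of an atomic map are terminal, every subcontinuum lies in a fiber or contains one.
A fiber is ample, because the preimage of a connected neighbourhood of a point is connected, and it
has empty interior, so that its proper subcontinua are filament. Hence the fibers are the minimal
ample subcontinua, and the filament subcontinua lie in fibers, a closed condition, so that the
Planck boundary consists of fibers. Conversely a nondegenerate continuum is a limit of its proper
subcontinua: by boundary bumping the order of the hyperspace is dense, whereas a continuum which is
not such a limit would have a maximal proper subcontinuum by Zorn's lemma. Finally, the fibers of a
map which is both open and closed depend continuously on the base point.
-/

namespace PlanckBoundary

section Components

variable {X : Type*} [TopologicalSpace X]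

theorem isClosed_connectedComponentIn {F : Set X} (hF : IsClosed F) (x : X) :
    IsClosed (connectedComponentIn F x) := by
  by_cases hx : x ∈ F
  · exact isClosed_of_closure_subset <|
      isPreconnected_connectedComponentIn.closure.subset_connectedComponentIn
        (subset_closure (mem_connectedComponentIn hx))
        (closure_minimal (connectedComponentIn_subset F x) hF)
  · rw [connectedComponentIn_eq_empty hx]
    exact isClosed_empty

theorem exists_isClopen_of_connectedComponent_subset [T2Space X] [CompactSpace X] {x : X}
    {U : Set X} (hU : IsOpen U) (hxU : connectedComponent x ⊆ U) :
    ∃ Z, IsClopen Z ∧ x ∈ Z ∧ Z ⊆ U := by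
  have : Nonempty {s : Set X // IsClopen s ∧ x ∈ s} := ⟨⟨univ, isClopen_univ, mem_univ x⟩⟩
  obtain ⟨⟨Z, hZ, hxZ⟩, hZU⟩ := exists_subset_nhds_of_compactSpace
    (V := fun s : {s : Set X // IsClopen s ∧ x ∈ s} => (s : Set X))
    (fun s t => ⟨⟨s.1 ∩ t.1, s.2.1.inter t.2.1, s.2.2, t.2.2⟩, inter_subset_left,
      inter_subset_right⟩)
    (fun s => s.2.1.isClosed)
    (fun y hy => hU.mem_nhds (hxU ((connectedComponent_eq_iInter_isClopen x).ge hy)))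
  exact ⟨Z, hZ, hxZ, hZU⟩

/-- Boundary bumping. -/
theorem connectedComponentIn_diff_inter_closure_nonempty [T2Space X] {K V : Set X}
    (hK : IsCompact K) (hKc : IsPreconnected K) (hV : IsOpen V) (hKV : (K ∩ V).Nonempty) {x : X}
    (hx : x ∈ K \ V) : (connectedComponentIn (K \ V) x ∩ closure V).Nonempty := by
  by_contra hdisj
  have : CompactSpace ↥(K \ V) := isCompact_iff_compactSpace.1 (hK.diff hV)
  obtain ⟨Z, hZ, hxZ, hZV⟩ : ∃ Z : Set ↥(K \ V),
      IsClopen Z ∧ ⟨x, hx⟩ ∈ Z ∧ Z ⊆ (↑) ⁻¹' (closure V)ᶜ := by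
    refine exists_isClopen_of_connectedComponent_subset
      (isClosed_closure.isOpen_compl.preimage continuous_subtype_val) fun y hy hyV => hdisj ?_
    rw [connectedComponentIn_eq_image hx]
    exact ⟨y, mem_image_of_mem _ hy, hyV⟩
  have hclosed {T : Set ↥(K \ V)} (hT : IsClosed T) : IsClosed ((↑) '' T : Set X) :=
    (hT.isCompact.image continuous_subtype_val).isClosed
  have hcover : K ⊆ (↑) '' Z ∪ ((↑) '' Zᶜ ∪ closure V) := by
    intro y hy
    by_cases hyV : y ∈ V
    · exact Or.inr (Or.inr (subset_closure hyV))
    · by_cases hyZ : ⟨y, hy, hyV⟩ ∈ Z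
      · exact Or.inl ⟨_, hyZ, rfl⟩
      · exact Or.inr (Or.inl ⟨_, hyZ, rfl⟩)
  obtain ⟨_, -, ⟨y, hyZ, rfl⟩, ⟨z, hzZ, hzy⟩ | hyV⟩ :=
    isPreconnected_closed_iff.1 hKc _ _ (hclosed hZ.isClosed)
      ((hclosed hZ.compl.isClosed).union isClosed_closure) hcover ⟨x, hx.1, _, hxZ, rfl⟩
      (hKV.mono fun y hy => ⟨hy.1, Or.inr (subset_closure hy.2)⟩)
  · exact hzZ (Subtype.ext hzy ▸ hyZ)
  · exact hZV hyZ hyV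

end Components

section Hyperspace

variable {X : Type*} [MetricSpace X] {K L : Hyperspace X}

/-- A compact connected set, bundled as a point of the hyperspace. -/
def IsSubcontinuum.toHyperspace {K : Set X} (hK : IsSubcontinuum K) : Hyperspace X :=
  ⟨⟨⟨K, hK.1⟩, hK.2.nonempty⟩, hK.2⟩

theorem Hyperspace.isSubcontinuum (K : Hyperspace X) : IsSubcontinuum (K.1 : Set X) :=
  ⟨K.1.isCompact, K.2⟩

instance : DenselyOrdered (Hyperspace X) where
  dense M K hMK := by
    obtain ⟨z, hzK, hzM⟩ := not_subset.1 hMK.not_ge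
    obtain ⟨x, hxM⟩ := M.1.nonempty
    -- Enlarge `M` to its component in the complement of a small neighbourhood `W` of `z`.
    obtain ⟨W, hW, hzW, hWM⟩ := normal_exists_closure_subset (isClosed_singleton (x := z))
      M.1.isCompact.isClosed.isOpen_compl (singleton_subset_iff.2 hzM)
    have hMW : (M.1 : Set X) ⊆ (K.1 : Set X) \ W := fun y hy =>
      ⟨hMK.le hy, fun hyW => hWM (subset_closure hyW) hy⟩
    have hC : IsSubcontinuum (connectedComponentIn ((K.1 : Set X) \ W) x) :=
      ⟨(K.1.isCompact.diff hW).of_isClosed_subset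
        (isClosed_connectedComponentIn (K.1.isCompact.diff hW).isClosed x)
        (connectedComponentIn_subset _ x), isConnected_connectedComponentIn_iff.2 (hMW hxM)⟩
    obtain ⟨y, hyC, hyW⟩ := connectedComponentIn_diff_inter_closure_nonempty K.1.isCompact
      K.2.isPreconnected hW ⟨z, hzK, hzW rfl⟩ (hMW hxM)
    refine ⟨hC.toHyperspace, lt_of_le_not_ge ?_ fun h => hWM hyW (h hyC), lt_of_le_not_ge ?_ ?_⟩
    · exact M.2.isPreconnected.subset_connectedComponentIn hxM hMW
    · exact (connectedComponentIn_subset _ x).trans sdiff_subset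
    · exact fun h => (connectedComponentIn_subset _ x (h hzK)).2 (hzW rfl)

theorem isSubcontinuum_closure_biUnion {c : Set (Hyperspace X)} (hne : c.Nonempty)
    (hc : DirectedOn (· ≤ ·) c) (hbdd : BddAbove c) :
    IsSubcontinuum (closure (⋃ L ∈ c, (L.1 : Set X))) := by
  obtain ⟨K, hK⟩ := hbdd
  refine ⟨K.1.isCompact.closure_of_subset (iUnion₂_subset hK), IsConnected.closure ⟨?_, ?_⟩⟩
  · obtain ⟨L, hL⟩ := hne
    exact L.1.nonempty.mono (subset_biUnion_of_mem hL)
  · rw [← sUnion_image]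
    exact IsPreconnected.sUnion_directed (directedOn_image.2 hc)
      (forall_mem_image.2 fun L _ => L.2.isPreconnected)

theorem mem_closure_of_directedOn {c : Set (Hyperspace X)} (hne : c.Nonempty)
    (hc : DirectedOn (· ≤ ·) c) (hK : K ∈ upperBounds c)
    (hKc : (K.1 : Set X) ⊆ closure (⋃ L ∈ c, (L.1 : Set X))) : K ∈ closure c := by
  rw [closure_subtype, NonemptyCompacts.isTopologicalBasis.mem_closure_iff]
  rintro _ ⟨u, ⟨hu, -, huo⟩, rfl⟩ ⟨hKu, hmeet⟩
  have hpoint : ∀ U ∈ u, ∃ y ∈ U, y ∈ ⋃ L ∈ c, (L.1 : Set X) := fun U hU =>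
    let ⟨_, hxK, hxU⟩ := hmeet U hU
    mem_closure_iff.1 (hKc hxK) U (huo U hU) hxU
  have : Nonempty X := K.1.nonempty.to_type
  choose! y hyU hyc using hpoint
  obtain ⟨L, hL, hyL⟩ := hc.exists_mem_subset_of_finset_subset_biUnion
    (f := fun L : Hyperspace X => (L.1 : Set X)) hne (s := (hu.image y).toFinset)
    ((hu.image y).coe_toFinset.trans_subset (image_subset_iff.2 hyc))
  rw [Finite.coe_toFinset, image_subset_iff] at hyL
  exact ⟨L.1, ⟨subset_trans (hK hL) hKu, fun U hU => ⟨y U, hyL hU, hyU U hU⟩⟩,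
    mem_image_of_mem _ hL⟩

theorem exists_isLUB_mem_closure {c : Set (Hyperspace X)} (hne : c.Nonempty)
    (hc : DirectedOn (· ≤ ·) c) (hbdd : BddAbove c) : ∃ M ∈ closure c, IsLUB c M := by
  let M := (isSubcontinuum_closure_biUnion hne hc hbdd).toHyperspace
  have hM : M ∈ upperBounds c := fun L hL =>
    (subset_biUnion_of_mem (u := fun L : Hyperspace X => (L.1 : Set X)) hL).trans subset_closure
  exact ⟨M, mem_closure_of_directedOn hne hc hM Subset.rfl, hM, fun K hK =>
    closure_minimal (iUnion₂_subset hK) K.1.isCompact.isClosed⟩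

theorem mem_closure_Iio (hK : (K.1 : Set X).Nontrivial) : K ∈ closure (Iio K) := by
  by_contra hKc
  obtain ⟨x, hx, z, hz, hxz⟩ := hK
  let S : Hyperspace X := ⟨{x}, isConnected_singleton⟩
  have hSK : S < K :=
    lt_of_le_not_ge (singleton_subset_iff.2 hx) fun hKS => hxz (hKS hz).symm
  have hchain : ∀ c ⊆ Iio K, IsChain (· ≤ ·) c → ∀ L ∈ c, ∃ N ∈ Iio K, ∀ L ∈ c, L ≤ N := by
    intro c hcK hc L hL
    have hKub : K ∈ upperBounds c := fun N hN => (hcK hN).le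
    obtain ⟨N, hNc, hN⟩ := exists_isLUB_mem_closure ⟨L, hL⟩ hc.directedOn ⟨K, hKub⟩
    exact ⟨N, lt_of_le_of_ne (hN.2 hKub) fun hNK => hKc (hNK ▸ closure_mono hcK hNc), hN.1⟩
  obtain ⟨M, -, hM⟩ := zorn_le_nonempty₀ (Iio K) hchain S hSK
  have hMK : M < K := hM.prop
  obtain ⟨L, hML, hLK⟩ := exists_between hMK
  exact hM.not_gt hLK hML

theorem IsFilament.mono (hL : IsFilament L) (hKL : K ≤ L) : IsFilament K := by
  obtain ⟨U, hU, hLU, hint⟩ := hL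
  exact ⟨U, hU, subset_trans hKL hLU, fun x hx => hint x (hKL hx)⟩

theorem IsAmple.not_isFilament (hK : IsAmple K) : ¬ IsFilament K := by
  rintro ⟨U, hU, hKU, hint⟩
  obtain ⟨M, hKM, hMU⟩ := hK U hU hKU
  obtain ⟨x, hx⟩ := K.1.nonempty
  have hMC : (M.1 : Set X) ⊆ connectedComponentIn U x :=
    M.2.isPreconnected.subset_connectedComponentIn (interior_subset (hKM hx)) hMU
  exact (hint x hx).le (interior_mono hMC (hKM hx))

theorem IsTerminal.isFilament_of_lt [LocallyCompactSpace X] (hL : IsTerminal (L.1 : Set X))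
    (hint : interior (L.1 : Set X) = ∅) (hKL : K < L) : IsFilament K := by
  obtain ⟨p, hpL, hpK⟩ := not_subset.1 hKL.not_ge
  obtain ⟨U, hU, hKU, hUp, hUc⟩ := exists_open_between_and_isCompact_closure K.1.isCompact
    (isOpen_compl_singleton (x := p)) (subset_compl_singleton_iff.2 hpK)
  refine ⟨U, hU, hKU, fun x hx => ?_⟩
  have hC : IsSubcontinuum (closure (connectedComponentIn U x)) :=
    ⟨hUc.closure_of_subset ((connectedComponentIn_subset U x).trans subset_closure),
      (isConnected_connectedComponentIn_iff.2 (hKU hx)).closure⟩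
  have hxC : x ∈ closure (connectedComponentIn U x) :=
    subset_closure (mem_connectedComponentIn (hKU hx))
  rcases hL.2 _ hC ⟨x, hKL.le hx, hxC⟩ with hLC | hCL
  · exact absurd rfl (hUp (closure_mono (connectedComponentIn_subset U x) (hLC hpL)))
  · exact subset_empty_iff.1 (hint ▸ interior_mono (subset_closure.trans hCL))

theorem isClosed_setOf_exists_subset_preimage_singleton {Y : Type*} [TopologicalSpace Y]
    [T2Space Y] {f : X → Y} (hf : Continuous f) :
    IsClosed {K : Hyperspace X | ∃ y, (K.1 : Set X) ⊆ f ⁻¹' {y}} := by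
  convert NonemptyCompacts.isClosedEmbedding_singleton.isClosed_range.preimage
    (hf.nonemptyCompacts_map.comp continuous_subtype_val) using 1
  ext K
  refine exists_congr fun y => ?_
  rw [← image_subset_iff, (K.1.nonempty.image f).subset_singleton_iff]
  exact eq_comm.trans (SetLike.coe_set_eq (p := ({y} : NonemptyCompacts Y)) (q := K.1.map f hf))

end Hyperspace

namespace IsAtomic

variable {X Y : Type*} [MetricSpace X] {f : X → Y} (hf : IsAtomic f) {K : Hyperspace X}

/-- The point-inverse of `y` under an atomic map, as a point of the hyperspace. -/
def fiber (y : Y) : Hyperspace X := (hf y).1.toHyperspace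

include hf in
theorem surjective : Function.Surjective f := fun y => (hf y).1.2.nonempty

theorem exists_le_fiber_or_fiber_le (K : Hyperspace X) :
    ∃ y, K ≤ hf.fiber y ∨ hf.fiber y ≤ K := by
  obtain ⟨x, hx⟩ := K.1.nonempty
  exact ⟨f x, ((hf (f x)).2 _ K.isSubcontinuum ⟨x, rfl, hx⟩).symm⟩

theorem exists_le_fiber_of_isFilament (hamp : ∀ y, IsAmple (hf.fiber y)) (hK : IsFilament K) :
    ∃ y, K ≤ hf.fiber y :=
  (hf.exists_le_fiber_or_fiber_le K).imp fun y h =>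
    h.resolve_right fun hle => (hamp y).not_isFilament (hK.mono hle)

section LocallyCompact

variable [LocallyCompactSpace X] (hint : ∀ y, interior (f ⁻¹' {y}) = ∅)

include hint

theorem eq_fiber_of_isAmple (hK : IsAmple K) {y : Y} (hle : K ≤ hf.fiber y) : K = hf.fiber y := by
  by_contra hne
  exact hK.not_isFilament ((hf y).isFilament_of_lt (hint y) (lt_of_le_of_ne hle hne))

theorem setOf_isMinimalAmple (hamp : ∀ y, IsAmple (hf.fiber y)) :
    {K : Hyperspace X | IsMinimalAmple K} = range hf.fiber := by
  ext K
  constructor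
  · rintro ⟨hK, hmin⟩
    obtain ⟨y, hle | hge⟩ := hf.exists_le_fiber_or_fiber_le K
    · exact ⟨y, (hf.eq_fiber_of_isAmple hint hK hle).symm⟩
    · exact ⟨y, hmin _ (hamp y) hge⟩
  · rintro ⟨y, rfl⟩
    exact ⟨hamp y, fun L hL hle => hf.eq_fiber_of_isAmple hint hL hle⟩

theorem fiber_mem_closure_filamentPortion {y : Y} (hy : (f ⁻¹' {y}).Nontrivial) :
    hf.fiber y ∈ closure (filamentPortion X) :=
  closure_mono (fun _ hK => (hf y).isFilament_of_lt (hint y) hK) (mem_closure_Iio hy)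

theorem planckBoundary_eq_range_fiber [TopologicalSpace Y] [T2Space Y] (hcont : Continuous f)
    (hamp : ∀ y, IsAmple (hf.fiber y)) (hnontriv : ∀ y, (f ⁻¹' {y}).Nontrivial) :
    planckBoundary X = range hf.fiber := by
  ext K
  constructor
  · rintro ⟨hK, hcl⟩
    obtain ⟨y, hle⟩ := closure_minimal (fun L hL => hf.exists_le_fiber_of_isFilament hamp hL)
      (isClosed_setOf_exists_subset_preimage_singleton hcont) hcl
    exact ⟨y, (hf.eq_fiber_of_isAmple hint hK hle).symm⟩
  · rintro ⟨y, rfl⟩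
    exact ⟨hamp y, hf.fiber_mem_closure_filamentPortion hint (hnontriv y)⟩

end LocallyCompact

variable [TopologicalSpace Y]

theorem isAmple_fiber [CompactSpace X] [T2Space Y] [LocallyConnectedSpace Y] (hcont : Continuous f)
    (y : Y) : IsAmple (hf.fiber y) := by
  intro U hU hyU
  have : CompactSpace Y := hf.surjective.compactSpace hcont
  have hclosed : IsClosedMap f := hcont.isClosedMap
  have hnear : {z | f ⁻¹' {z} ⊆ U} ∈ 𝓝 y :=
    hclosed.eventually_nhds_fiber y (p := (· ∈ U)) fun x hx => hU.mem_nhds (hyU hx)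
  obtain ⟨N, hN, hNc, hNU⟩ := exists_mem_nhds_isClosed_subset hnear
  have hJ : connectedComponentIn N y ∈ 𝓝 y := connectedComponentIn_mem_nhds hN
  have hJc : IsClosed (connectedComponentIn N y) := isClosed_connectedComponentIn hNc y
  have hL : IsSubcontinuum (f ⁻¹' connectedComponentIn N y) :=
    ⟨(hJc.preimage hcont).isCompact,
      (hclosed.isQuotientMap hcont hf.surjective).isCoinducing.isConnected_preimage_of_isClosed
        (fun z => (hf z).1.2) hJc (isConnected_connectedComponentIn_iff.2 (mem_of_mem_nhds hN))⟩
  refine ⟨hL.toHyperspace, fun x (hx : f x = y) => ?_, fun x hx => ?_⟩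
  · exact mem_interior_iff_mem_nhds.2 (hcont.continuousAt (hx ▸ hJ))
  · exact hNU (connectedComponentIn_subset N y hx) rfl

theorem continuous_fiber (hclosed : IsClosedMap f) (hopen : IsOpenMap f) :
    Continuous hf.fiber := by
  let _ : TopologicalSpace (Set X) := TopologicalSpace.vietoris X
  refine Continuous.subtype_mk (NonemptyCompacts.isEmbedding_coe.continuous_iff.2
    (vietoris.continuous_iff.2 ⟨fun U hU => ?_, fun F hF => ?_⟩)) _
  · exact isOpen_iff_mem_nhds.2 fun y hy =>
      hclosed.eventually_nhds_fiber y (p := (· ∈ U)) fun x hx => hU.mem_nhds (hy hx)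
  · have hcompl : {y | f ⁻¹' {y} ⊆ F} = (f '' Fᶜ)ᶜ := by
      ext y
      exact ⟨fun h ⟨x, hxF, hxy⟩ => hxF (h hxy),
        fun h x hxy => by_contra fun hxF => h ⟨x, hxF, hxy⟩⟩
    change IsClosed {y | f ⁻¹' {y} ⊆ F}
    rw [hcompl]
    exact (hopen _ hF.isOpen_compl).isClosed_compl

end IsAtomic

theorem JonesDecomposition.range_fiber {Ψ : Type*} [MetricSpace Ψ] (D : JonesDecomposition Ψ) :
    range D.isAtomic_proj.fiber = {K | ∃ α ∈ Ico (0 : ℝ) (2 * Real.pi), K = D.P α} := by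
  ext K
  constructor
  · rintro ⟨y, rfl⟩
    obtain ⟨α, rfl⟩ := Circle.exp_surjective y
    obtain ⟨β, hβ, hαβ⟩ := Circle.periodic_exp.exists_mem_Ico₀ Real.two_pi_pos α
    exact ⟨β, hβ, congrArg D.isAtomic_proj.fiber hαβ⟩
  · rintro ⟨α, -, rfl⟩
    exact ⟨Circle.exp α, rfl⟩

instance : Nontrivial Circle := ⟨Circle.exp Real.pi, 1, Circle.exp_pi_ne_one⟩

instance : LocallyConnectedSpace Circle :=
  ChartedSpace.locallyConnectedSpace (EuclideanSpace ℝ (Fin 1)) Circle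

end PlanckBoundary

open PlanckBoundary in
theorem mainTheorem4_general {X Y : Type*} [MetricSpace X] [CompactSpace X] [ConnectedSpace X]
    [TopologicalSpace Y] [T2Space Y] [LocallyConnectedSpace Y] [Nontrivial Y] {f : X → Y}
    (hf : IsAtomic f) (hcont : Continuous f) (hopen : IsOpenMap f)
    (hnontriv : ∀ y, (f ⁻¹' {y}).Nontrivial) :
    IsSubcontinuum (planckBoundary X) ∧
    planckBoundary X = {K : Hyperspace X | IsMinimalAmple K} ∧
    {K : Hyperspace X | IsMinimalAmple K} = range hf.fiber := by
  have : ConnectedSpace Y := hf.surjective.connectedSpace hcont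
  have : CompactSpace Y := hf.surjective.compactSpace hcont
  have hint (y : Y) : interior (f ⁻¹' {y}) = ∅ := by
    rw [← hopen.preimage_interior_eq_interior_preimage hcont, interior_singleton, preimage_empty]
  have hamp := hf.isAmple_fiber hcont
  have hfiber : Continuous hf.fiber := hf.continuous_fiber hcont.isClosedMap hopen
  rw [hf.planckBoundary_eq_range_fiber hint hcont hamp hnontriv, hf.setOf_isMinimalAmple hint hamp]
  exact ⟨⟨isCompact_range hfiber, isConnected_range hfiber⟩, rfl, rfl⟩

theorem mainTheorem4 {Ψ : Type*} [MetricSpace Ψ] [CompactSpace Ψ] [ConnectedSpace Ψ]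
    (D : PlanckBoundary.JonesDecomposition Ψ) :
    PlanckBoundary.IsSubcontinuum (PlanckBoundary.planckBoundary Ψ) ∧
    PlanckBoundary.planckBoundary Ψ =
      {K : PlanckBoundary.Hyperspace Ψ | PlanckBoundary.IsMinimalAmple K} ∧
    {K : PlanckBoundary.Hyperspace Ψ | PlanckBoundary.IsMinimalAmple K} =
      {K : PlanckBoundary.Hyperspace Ψ | ∃ α ∈ Set.Ico (0 : ℝ) (2 * Real.pi), K = D.P α} := by
  rw [← D.range_fiber]
  exact mainTheorem4_general D.isAtomic_proj D.continuous_proj D.isOpenMap_proj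
    fun y => nontrivial_coe_sort.1 (D.isPseudoArc_fiber y).nontrivial
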